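/- Let $\mathbb K$ be an infinite field, $R=\mathbb K[x_0,\dots,x_n]$ the standard graded polynomial ring, and let $n,s,a,b,m$ be positive integers with $s\ge n+1$, $(b-1)s+1<a\le sb$. Put $$\delta=a-(b-1)s-1,\qquad c_0=s-\left\lfloor\frac{a-1}{b}\right\rfloor,\qquad \mu_a^0=a-b(s-c_0),$$ and assume $\delta\ge s-n$. (Then $1\le c_0\le s-\delta\le n$, and $1\le \mu_a^0\le b$.) Let $\mathcal F=\{f_1,\dots,f_s\}$ be a set of forms in $R$ of one common degree $d$ which is $(s-\delta)$-generic, meaning that every subset of $\mathcal F$ with at most $s-\delta+1$ elements forms a regular sequence. Let $I_a(\mathcal F^b)=\langle f_1^{n_1}\cdots f_s^{n_s} : 0\le n_i\le b,\ \sum_i n_i=a\rangle$, let $I_{c,\mathcal F}=\bigcap_{1\le i_1<\cdots<i_c\le s}\langle f_{i_1},\dots,f_{i_c}\rangle$ for $1\le c\le s$, and for an ideal $I$ of $R$ and a positive integer $k$ let $I^{(k)}=\bigcap_{\mathfrak p\in\operatorname{Ass}(R/I)}(I^kR_{\mathfrak p}\cap R)$ be its $k$-th symbolic power. Then $$I_a(\mathcal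 F^b)^{(m)}=\bigcap_{c=c_0}^{s-\delta}\ \bigcap_{1\le i_1<\cdots<i_c\le s}\langle f_{i_1},\dots,f_{i_c}\rangle^{m(\mu_a^0+b(c-c_0))}=\bigcap_{c=c_0}^{s-\delta} I_{c,\mathcal F}^{(m(\mu_a^0+b(c-c_0)))}.$$ -/

import Mathlib

namespace StarConfig

section

variable {R : Type*} [CommRing R] {s : ℕ}

/-- The family `f` is `c`-generic: any subset of at most `c + 1` of its members forms a regular
sequence, whatever the order in which the members are listed. (A regular sequence of forms of
positive degree remains regular under every permutation, so for forms the order is immaterial.) -/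
def IsGeneric (f : Fin s → R) (c : ℕ) : Prop :=
  ∀ l : List (Fin s), l.Nodup → l.length ≤ c + 1 →
    RingTheory.Sequence.IsRegular R (l.map f)

/-- The `a`-fold product ideal `I_a(f₁^{m₁} ⋯ f_s^{m_s})`, generated by the products
`f₁^{n₁} ⋯ f_s^{n_s}` with `0 ≤ n_i ≤ m_i` and `n₁ + ⋯ + n_s = a`. -/
def aFoldProductIdeal (f : Fin s → R) (mult : Fin s → ℕ) (a : ℕ) : Ideal R :=
  Ideal.span {g | ∃ e : Fin s → ℕ, (∀ i, e i ≤ mult i) ∧ ∑ i, e i = a ∧ g = ∏ i, f i ^ e i}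

/-- The ideal `⟨f_i : i ∈ A⟩`. -/
def subfamilyIdeal (f : Fin s → R) (A : Finset (Fin s)) : Ideal R :=
  Ideal.span (f '' (A : Set (Fin s)))

/-- The star configuration ideal `I_{c,F}`, the intersection of the ideals
`⟨f_{i₁}, …, f_{i_c}⟩` over all `i₁ < ⋯ < i_c`. -/
def starIdeal (f : Fin s → R) (c : ℕ) : Ideal R :=
  ⨅ A : Finset (Fin s), ⨅ _ : A.card = c, subfamilyIdeal f A

/-- The `m`-th symbolic power of `I`: the intersection of the contractions `I^m R_p ∩ R`, where `p`
runs over all the associated primes of `R ⧸ I` (embedded ones included). -/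
noncomputable def symbolicPower (I : Ideal R) (m : ℕ) : Ideal R :=
  ⨅ p : associatedPrimes R (R ⧸ I),
    ((I ^ m).map (algebraMap R (Localization.AtPrime p.1))).comap
      (algebraMap R (Localization.AtPrime p.1))

end

end StarConfig

namespace StarConfig

section

variable {R : Type*} [CommRing R] {s : ℕ}

/-! Write `u = s*b - a`, so that `s - δ = u + 1`. Relative to `f₁^b ⋯ f_s^b`, the product ideal `I`
is generated by products missing at most `u` factors. For a generic family such an ideal equals the
intersection of the powers `⟨f_A⟩^(b|A| - u)` over `|A| ≤ u + 1` (`deficitIdeal_le_pow`,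
`mem_sup_deficitIdeal`), because elements regular modulo a regular sequence stay regular modulo its
powers (`regularMod_pow`).

The associated primes of each `⟨f_A⟩` with a positive exponent are associated to `I`
(`mem_associatedPrimes_deficitIdeal`); with prime avoidance this bounds the symbolic power from
above. Conversely, an associated prime of `I` contains at most `u + 1` of the forms. Locally only
these matter, and for them balanced rounding shows that the intersection of the powers with
exponents multiplied by `m` lies in the ordinary `m`-th power (`deficitIdeal_le_deficitIdeal_pow`).
-/

/-- `h` is a nonzerodivisor modulo the ideal `I`. -/
def RegularMod (h : R) (I : Ideal R) : Prop :=
  ∀ x, h * x ∈ I → x ∈ I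

/-- Modulo `C`, any subset of at most `t + 1` members of `{f i : i ∈ B}` is a weakly regular
sequence in any order. -/
def GenericMod (C : Ideal R) (f : Fin s → R) (B : Finset (Fin s)) (t : ℕ) : Prop :=
  ∀ A ⊆ B, A.card ≤ t → ∀ j ∈ B, j ∉ A → RegularMod (f j) (C ⊔ subfamilyIdeal f A)

lemma RegularMod.pow {h : R} {I : Ideal R} (H : RegularMod h I) (k : ℕ) :
    RegularMod (h ^ k) I := by
  induction k with
  | zero => intro x hx; simpa using hx
  | succ k ih =>
    intro x hx
    rw [pow_succ, mul_assoc] at hx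
    exact H _ (ih _ hx)

lemma RegularMod.prod {ι : Type*} {h : ι → R} {I : Ideal R} {T : Finset ι}
    (H : ∀ i ∈ T, RegularMod (h i) I) : RegularMod (∏ i ∈ T, h i) I := by
  classical
  induction T using Finset.induction_on with
  | empty => intro x hx; simpa using hx
  | insert i T hi ih =>
    intro x hx
    rw [Finset.prod_insert hi, mul_assoc] at hx
    exact ih (fun j hj => H j (Finset.mem_insert_of_mem hj)) _
      (H i (Finset.mem_insert_self i T) _ hx)

lemma subfamilyIdeal_empty (f : Fin s → R) : subfamilyIdeal f ∅ = ⊥ := by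
  simp [subfamilyIdeal]

lemma subfamilyIdeal_insert (f : Fin s → R) (i : Fin s) (A : Finset (Fin s)) :
    subfamilyIdeal f (insert i A) = Ideal.span {f i} ⊔ subfamilyIdeal f A := by
  simp only [subfamilyIdeal, Finset.coe_insert, Set.image_insert_eq]
  exact Ideal.span_insert _ _

lemma mem_subfamilyIdeal (f : Fin s → R) {i : Fin s} {A : Finset (Fin s)} (h : i ∈ A) :
    f i ∈ subfamilyIdeal f A :=
  Ideal.subset_span ⟨i, by simpa using h, rfl⟩

lemma mem_sup_span_singleton_sup {C D : Ideal R} {g x : R}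
    (h : x ∈ (C ⊔ Ideal.span {g}) ⊔ D) : ∃ y ∈ C ⊔ D, ∃ z, x = y + g * z := by
  rw [sup_right_comm] at h
  obtain ⟨y, hy, w, hw, rfl⟩ := Submodule.mem_sup.1 h
  obtain ⟨z, rfl⟩ := Ideal.mem_span_singleton'.1 hw
  exact ⟨y, hy, z, by rw [mul_comm]⟩

/-! ### Regular elements modulo powers -/

lemma sup_pow_succ_le (a b : Ideal R) (k : ℕ) :
    (a ⊔ b) ^ (k + 1) ≤ b ^ (k + 1) ⊔ a * (a ⊔ b) ^ k := by
  induction k with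
  | zero => simp [sup_comm]
  | succ k ih =>
    rw [pow_succ']
    refine (Ideal.mul_mono_right ih).trans ?_
    rw [Ideal.mul_sup, Ideal.sup_mul]
    refine sup_le (sup_le ?_ ?_) ?_
    · refine le_sup_of_le_right (Ideal.mul_mono_right (Ideal.pow_right_mono le_sup_right _))
    · rw [← pow_succ']
      exact le_sup_left
    · refine le_sup_of_le_right ?_
      rw [mul_left_comm, ← pow_succ']

lemma sup_pow_le_sup_pow (a b : Ideal R) (k : ℕ) : (a ⊔ b) ^ k ≤ a ⊔ b ^ k := by
  cases k with
  | zero => simp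
  | succ k =>
    exact (sup_pow_succ_le a b k).trans (sup_le le_sup_right (le_sup_of_le_left Ideal.mul_le_left))

/-- Modulo `C + D^(k+1)`, the element `g * x` agrees with some `g * w`, `w ∈ (g, D)^k`; cancelling
`g` gives `x` up to `D^(k+1)`. -/
lemma mem_of_mul_mem_sup_pow {C D : Ideal R} {g : R} {k : ℕ}
    (hg : RegularMod g (C ⊔ D ^ (k + 1))) {x : R}
    (hx : g * x ∈ C ⊔ (Ideal.span {g} ⊔ D) ^ (k + 1)) :
    x ∈ C ⊔ (Ideal.span {g} ⊔ D) ^ k := by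
  have h1 : g * x ∈ (C ⊔ D ^ (k + 1)) ⊔ Ideal.span {g} * (Ideal.span {g} ⊔ D) ^ k := by
    rw [sup_assoc]
    exact sup_le_sup_left (sup_pow_succ_le _ _ _) C hx
  obtain ⟨u, hu, v, hv, huv⟩ := Submodule.mem_sup.1 h1
  obtain ⟨w, hw, rfl⟩ := Ideal.mem_span_singleton_mul.1 hv
  have h2 : x - w ∈ C ⊔ D ^ (k + 1) := hg _ (by
    rw [mul_sub, ← huv, add_sub_cancel_right]; exact hu)
  have h3 : C ⊔ D ^ (k + 1) ≤ C ⊔ (Ideal.span {g} ⊔ D) ^ k :=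
    sup_le_sup_left ((Ideal.pow_le_pow_right (Nat.le_succ k)).trans
      (Ideal.pow_right_mono le_sup_right k)) C
  have := add_mem (h3 h2) (Ideal.mem_sup_right (S := C) hw)
  simpa using this

lemma GenericMod.mono {C : Ideal R} {f : Fin s → R} {B B' : Finset (Fin s)} {t t' : ℕ}
    (H : GenericMod C f B t) (hB : B' ⊆ B) (ht : t' ≤ t) : GenericMod C f B' t' :=
  fun A hA hc j hj hjA => H A (hA.trans hB) (hc.trans ht) j (hB hj) hjA

/-- Subsets of `B` never exceed `t` elements, so the bound is vacuous. This later allows the large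
deficit bound `m * u + 1`. -/
lemma GenericMod.of_card_le {C : Ideal R} {f : Fin s → R} {B : Finset (Fin s)} {t : ℕ}
    (H : GenericMod C f B t) (hB : B.card ≤ t) (t' : ℕ) : GenericMod C f B t' :=
  fun A hA _ j hj hjA => H A hA ((Finset.card_le_card hA).trans hB) j hj hjA

lemma GenericMod.sup_span {C : Ideal R} {f : Fin s → R} {B : Finset (Fin s)} {i : Fin s} {t : ℕ}
    (hi : i ∉ B) (H : GenericMod C f (insert i B) (t + 1)) :
    GenericMod (C ⊔ Ideal.span {f i}) f B t := by
  intro A hA hc j hj hjA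
  rw [sup_assoc, ← subfamilyIdeal_insert]
  refine H _ (Finset.insert_subset_insert _ hA) ?_ j (Finset.mem_insert_of_mem hj) ?_
  · exact (Finset.card_insert_le _ _).trans (by omega)
  · rw [Finset.mem_insert]
    rintro (rfl | h)
    · exact hi hj
    · exact hjA h

/-- A nonzerodivisor modulo an ideal generated by a regular sequence is a nonzerodivisor modulo
the powers of that ideal. -/
theorem regularMod_pow (f : Fin s → R) (A : Finset (Fin s)) :
    ∀ (C : Ideal R), GenericMod C f A A.card → ∀ h : R, RegularMod h (C ⊔ subfamilyIdeal f A) →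
      ∀ k, RegularMod h (C ⊔ subfamilyIdeal f A ^ k) := by
  induction A using Finset.induction_on with
  | empty =>
    intro C _ h hh k
    cases k with
    | zero => intro x _; simp
    | succ k => simpa [subfamilyIdeal_empty, RegularMod] using hh
  | insert i A hi ih =>
    intro C H h hh k
    rw [Finset.card_insert_of_notMem hi] at H
    have hreg : ∀ k, RegularMod (f i) (C ⊔ subfamilyIdeal f A ^ k) :=
      ih C (H.mono (Finset.subset_insert _ _) (Nat.le_succ _)) (f i)
        (H A (Finset.subset_insert _ _) (Nat.le_succ _) i (Finset.mem_insert_self _ _) hi)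
    -- Varying `C` lets it absorb `f i`; what remains is a multiple `f i * z`, treated by induction
    -- on `k`.
    have hh' : ∀ k, RegularMod h ((C ⊔ Ideal.span {f i}) ⊔ subfamilyIdeal f A ^ k) :=
      ih _ (H.sup_span hi) h (by rwa [sup_assoc, ← subfamilyIdeal_insert])
    rw [subfamilyIdeal_insert]
    induction k with
    | zero => intro x _; simp
    | succ k ihk =>
      intro x hx
      have h1 : x ∈ (C ⊔ Ideal.span {f i}) ⊔ subfamilyIdeal f A ^ (k + 1) := by
        apply hh'
        rw [sup_assoc]
        exact sup_le_sup_left (sup_pow_le_sup_pow _ _ _) C hx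
      obtain ⟨y, hy, z, rfl⟩ := mem_sup_span_singleton_sup h1
      have hy' : y ∈ C ⊔ (Ideal.span {f i} ⊔ subfamilyIdeal f A) ^ (k + 1) :=
        sup_le_sup_left (Ideal.pow_right_mono le_sup_right _) C hy
      refine add_mem hy' ?_
      have h2 : f i * (h * z) ∈ C ⊔ (Ideal.span {f i} ⊔ subfamilyIdeal f A) ^ (k + 1) := by
        have := sub_mem hx (Ideal.mul_mem_left _ h hy')
        convert this using 1
        ring
      have hz := ihk _ (mem_of_mul_mem_sup_pow (hreg (k + 1)) h2)
      have h3 : f i * z ∈ Ideal.span {f i} * (C ⊔ (Ideal.span {f i} ⊔ subfamilyIdeal f A) ^ k) :=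
        Ideal.mul_mem_mul (Ideal.mem_span_singleton_self _) hz
      rw [Ideal.mul_sup] at h3
      have h4 : Ideal.span {f i} * (Ideal.span {f i} ⊔ subfamilyIdeal f A) ^ k ≤
          (Ideal.span {f i} ⊔ subfamilyIdeal f A) ^ (k + 1) := by
        rw [pow_succ']
        exact Ideal.mul_mono_left le_sup_left
      exact (sup_le_sup Ideal.mul_le_right h4 : _ ≤ C ⊔ _) h3

/-! ### Ideals of bounded deficit and their decomposition -/

/-- The ideal generated by the products `∏ i ∈ B, f i ^ e i` whose total deficit
`∑ i ∈ B, (mult i - e i)` with respect to `mult` is less than `t`. -/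
def deficitIdeal (f : Fin s → R) (B : Finset (Fin s)) (mult : Fin s → ℕ) (t : ℕ) : Ideal R :=
  Ideal.span {g | ∃ e : Fin s → ℕ, ∑ i ∈ B, (mult i - e i) < t ∧ g = ∏ i ∈ B, f i ^ e i}

lemma prod_mem_deficitIdeal (f : Fin s → R) {B : Finset (Fin s)} {mult e : Fin s → ℕ} {t : ℕ}
    (h : ∑ i ∈ B, (mult i - e i) < t) : ∏ i ∈ B, f i ^ e i ∈ deficitIdeal f B mult t :=
  Ideal.subset_span ⟨e, h, rfl⟩

lemma prod_pow_mem_subfamilyIdeal_pow (f : Fin s → R) {A B : Finset (Fin s)} (hA : A ⊆ B)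
    (e : Fin s → ℕ) {k : ℕ} (hk : k ≤ ∑ i ∈ A, e i) :
    ∏ i ∈ B, f i ^ e i ∈ subfamilyIdeal f A ^ k := by
  rw [← Finset.prod_sdiff hA]
  refine Ideal.mul_mem_left _ _ (Ideal.pow_le_pow_right hk ?_)
  rw [← Finset.prod_pow_eq_pow_sum]
  exact Ideal.prod_mem_prod fun i hi => Ideal.pow_mem_pow (mem_subfamilyIdeal f hi) _

lemma deficitIdeal_le_pow (f : Fin s → R) {A B : Finset (Fin s)} (hA : A ⊆ B)
    (mult : Fin s → ℕ) (t : ℕ) :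
    deficitIdeal f B mult t ≤ subfamilyIdeal f A ^ (∑ i ∈ A, mult i + 1 - t) := by
  refine Ideal.span_le.2 ?_
  rintro _ ⟨e, he, rfl⟩
  refine prod_pow_mem_subfamilyIdeal_pow f hA e ?_
  have h1 : ∑ i ∈ A, (mult i - e i) ≤ ∑ i ∈ B, (mult i - e i) :=
    Finset.sum_le_sum_of_subset hA
  have h2 : ∑ i ∈ A, mult i ≤ ∑ i ∈ A, (mult i - e i) + ∑ i ∈ A, e i := by
    rw [← Finset.sum_add_distrib]
    exact Finset.sum_le_sum fun i _ => by omega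
  omega

lemma sum_update_sub (B : Finset (Fin s)) {i : Fin s} (hi : i ∉ B) (mult e : Fin s → ℕ) (v : ℕ) :
    ∑ j ∈ insert i B, (mult j - Function.update e i v j) =
      (mult i - v) + ∑ j ∈ B, (mult j - e j) := by
  rw [Finset.sum_insert hi, Function.update_self]
  congr 1
  refine Finset.sum_congr rfl fun j hj => ?_
  rw [Function.update_of_ne (by rintro rfl; exact hi hj)]

lemma deficitIdeal_le_insert (f : Fin s → R) {B : Finset (Fin s)} {i : Fin s} (hi : i ∉ B)
    (mult : Fin s → ℕ) (t : ℕ) :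
    deficitIdeal f B mult (t - mult i) ≤ deficitIdeal f (insert i B) mult t := by
  refine Ideal.span_le.2 ?_
  rintro _ ⟨e, he, rfl⟩
  refine Ideal.subset_span ⟨Function.update e i 0, ?_, ?_⟩
  · rw [sum_update_sub B hi]
    omega
  · rw [Finset.prod_insert hi, Function.update_self, pow_zero, one_mul]
    refine Finset.prod_congr rfl fun j hj => ?_
    rw [Function.update_of_ne (by rintro rfl; exact hi hj)]

lemma mul_mem_deficitIdeal (f : Fin s → R) {B : Finset (Fin s)} {i : Fin s} (hi : i ∈ B)
    (mult : Fin s → ℕ) (t : ℕ) {z : R}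
    (hz : z ∈ deficitIdeal f B (Function.update mult i (mult i - 1)) t) :
    f i * z ∈ deficitIdeal f B mult t := by
  suffices h : deficitIdeal f B (Function.update mult i (mult i - 1)) t ≤
      Submodule.comap (LinearMap.mulLeft R (f i)) (deficitIdeal f B mult t) from h hz
  refine Ideal.span_le.2 ?_
  rintro _ ⟨e, he, rfl⟩
  refine Ideal.subset_span ⟨Function.update e i (e i + 1), lt_of_le_of_lt ?_ he, ?_⟩
  · refine Finset.sum_le_sum fun j _ => ?_
    by_cases h : j = i
    · subst h; simp only [Function.update_self]; omega
    · simp [Function.update_of_ne h]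
  · rw [LinearMap.mulLeft_apply, ← Finset.mul_prod_erase B _ hi, ← Finset.mul_prod_erase B _ hi,
      Function.update_self, ← mul_assoc, pow_succ']
    congr 1
    refine Finset.prod_congr rfl fun j hj => ?_
    rw [Function.update_of_ne (Finset.ne_of_mem_erase hj)]

/-- The primary decomposition of the ideals `deficitIdeal`. -/
theorem mem_sup_deficitIdeal (f : Fin s → R) (B : Finset (Fin s)) :
    ∀ (t : ℕ) (mult : Fin s → ℕ) (C : Ideal R), GenericMod C f B t → ∀ x : R,
      (∀ A ⊆ B, A.card ≤ t → x ∈ C ⊔ subfamilyIdeal f A ^ (∑ i ∈ A, mult i + 1 - t)) →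
      x ∈ C ⊔ deficitIdeal f B mult t := by
  induction B using Finset.induction_on with
  | empty =>
    intro t mult C _ x hx
    rcases Nat.eq_zero_or_pos t with rfl | ht
    · have := hx ∅ le_rfl le_rfl
      simp only [subfamilyIdeal_empty] at this
      simp only [Finset.sum_empty] at this
      exact Ideal.mem_sup_left (by simpa using this)
    · have h1 : (1 : R) ∈ deficitIdeal f ∅ mult t := by
        simpa using prod_mem_deficitIdeal f (B := ∅) (mult := mult) (e := 0) (by simpa using ht)
      rw [(Ideal.eq_top_iff_one _).2 h1]
      simp
  | insert i B hi ih =>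
    intro t mult C H x hx
    obtain ⟨k, hk⟩ : ∃ k, mult i = k := ⟨_, rfl⟩
    -- Inner induction on the multiplicity of `f i`: reduce modulo `f i`, then divide the remainder
    -- by `f i`, which lowers `mult i` by one.
    induction k generalizing mult x with
    | zero =>
      have h1 := ih t mult C (H.mono (Finset.subset_insert _ _) le_rfl) x
        fun A hA hc => hx A (hA.trans (Finset.subset_insert _ _)) hc
      have h2 := deficitIdeal_le_insert f hi mult t
      rw [hk] at h2
      exact sup_le_sup_left h2 C h1
    | succ k ihk =>
      rcases t with _ | t
      · have := hx ∅ (Finset.empty_subset _) le_rfl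
        exact Ideal.mem_sup_left (by simpa [subfamilyIdeal_empty] using this)
      have hne : ∀ {A : Finset (Fin s)}, A ⊆ B → i ∉ A := fun hA h => hi (hA h)
      -- Omitting `f i` altogether costs `mult i` of the allowed deficit; as `mult i ≥ 1`, the
      -- genericity left modulo `f i` suffices.
      have h1 : x ∈ (C ⊔ Ideal.span {f i}) ⊔ deficitIdeal f B mult (t + 1 - mult i) := by
        refine ih _ mult _ ((H.sup_span hi).mono subset_rfl (by omega)) x fun A hA hc => ?_
        have h2 := hx (insert i A) (Finset.insert_subset_insert _ hA)
          ((Finset.card_insert_le _ _).trans (by omega))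
        rw [subfamilyIdeal_insert, Finset.sum_insert (hne hA)] at h2
        rw [sup_assoc]
        refine sup_le_sup_left ((Ideal.pow_le_pow_right ?_).trans (sup_pow_le_sup_pow _ _ _)) C h2
        omega
      obtain ⟨y, hy, z, rfl⟩ := mem_sup_span_singleton_sup h1
      have hy' := sup_le_sup_left (deficitIdeal_le_insert f hi mult (t + 1)) C hy
      refine add_mem hy' ?_
      have hz : ∀ A ⊆ insert i B, A.card ≤ t + 1 →
          f i * z ∈ C ⊔ subfamilyIdeal f A ^ (∑ i ∈ A, mult i + 1 - (t + 1)) := by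
        intro A hA hc
        have h3 := sub_mem (hx A hA hc) (sup_le_sup_left (deficitIdeal_le_pow f hA mult _) C hy')
        simpa using h3
      have hz' : z ∈ C ⊔ deficitIdeal f (insert i B)
          (Function.update mult i (mult i - 1)) (t + 1) := by
        refine ihk _ z (fun A hA hc => ?_) (by simp [hk])
        have key : ∀ A' ⊆ insert i B, A'.card ≤ t + 1 → i ∉ A' → ∀ k,
            RegularMod (f i) (C ⊔ subfamilyIdeal f A' ^ k) := fun A' hA' hc' hiA' =>
          regularMod_pow f A' C (H.mono hA' hc') _
            (H A' hA' hc' i (Finset.mem_insert_self _ _) hiA')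
        by_cases hiA : i ∈ A
        · obtain ⟨A', hiA', rfl⟩ : ∃ A', i ∉ A' ∧ insert i A' = A :=
            ⟨A.erase i, Finset.notMem_erase _ _, Finset.insert_erase hiA⟩
          have h4 := hz _ hA hc
          have hs : ∑ j ∈ A', Function.update mult i (mult i - 1) j = ∑ j ∈ A', mult j :=
            Finset.sum_congr rfl fun j hj => by
              rw [Function.update_of_ne (by rintro rfl; exact hiA' hj)]
          rw [Finset.sum_insert hiA', Function.update_self, hs]
          rw [Finset.sum_insert hiA'] at h4
          rw [subfamilyIdeal_insert] at h4 ⊢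
          rcases Nat.eq_zero_or_pos (mult i - 1 + ∑ j ∈ A', mult j + 1 - (t + 1)) with h0 | h0
          · rw [h0]; simp
          · refine mem_of_mul_mem_sup_pow (key A' ((Finset.subset_insert _ _).trans hA)
              ((Finset.card_le_card (Finset.subset_insert _ _)).trans hc) hiA' _) ?_
            convert h4 using 3
            omega
        · have hs : ∑ j ∈ A, Function.update mult i (mult i - 1) j = ∑ j ∈ A, mult j :=
            Finset.sum_congr rfl fun j hj => by
              rw [Function.update_of_ne (by rintro rfl; exact hiA hj)]
          rw [hs]
          exact key A hA hc hiA _ z (hz A hA hc)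
      obtain ⟨u, hu, v, hv, rfl⟩ := Submodule.mem_sup.1 hz'
      rw [mul_add]
      exact add_mem (Ideal.mem_sup_left (Ideal.mul_mem_left _ _ hu))
        (Ideal.mem_sup_right (mul_mem_deficitIdeal f (Finset.mem_insert_self _ _) mult _ hv))

/-! ### Splitting products by balanced rounding -/

lemma add_div_le_div_add (m a k : ℕ) : (a + k) / (m + 1) ≤ a / (m + 1) + k := by
  calc (a + k) / (m + 1) ≤ (a + (m + 1) * k) / (m + 1) :=
        Nat.div_le_div_right (Nat.add_le_add_left (Nat.le_mul_of_pos_left k m.succ_pos) a)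
    _ = a / (m + 1) + k := Nat.add_mul_div_left _ _ m.succ_pos

/-- A function on a finite set can be divided by `m + 1` with balanced rounding. -/
lemma exists_balanced_div {ι : Type*} (B : Finset ι) (G : ι → ℕ) (m b : ℕ)
    (hG : ∀ i ∈ B, G i ≤ (m + 1) * b) :
    ∃ g : ι → ℕ, (∀ i ∈ B, g i ≤ b ∧ g i ≤ G i ∧ G i ≤ g i + m * b) ∧
      ∑ i ∈ B, g i = (∑ i ∈ B, G i) / (m + 1) := by
  classical
  induction B using Finset.induction_on with
  | empty => exact ⟨0, by simp, by simp⟩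
  | insert i B hi ih =>
    obtain ⟨g, hg, hsum⟩ := ih fun j hj => hG j (Finset.mem_insert_of_mem hj)
    set S := ∑ j ∈ B, G j
    have hGi := hG i (Finset.mem_insert_self _ _)
    have h0 : (S + (m + 1) * b) / (m + 1) = S / (m + 1) + b :=
      Nat.add_mul_div_left _ _ (Nat.succ_pos m)
    have h1 : S / (m + 1) ≤ (S + G i) / (m + 1) := Nat.div_le_div_right (Nat.le_add_right _ _)
    have h2 : (S + G i) / (m + 1) ≤ S / (m + 1) + b := by
      rw [← h0]
      exact Nat.div_le_div_right (Nat.add_le_add_left hGi _)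
    have h3 := add_div_le_div_add m S (G i)
    have h4 := add_div_le_div_add m (S + G i) ((m + 1) * b - G i)
    rw [add_assoc, Nat.add_sub_cancel' hGi, h0] at h4
    have h5 : (m + 1) * b = m * b + b := by ring
    -- Differences of consecutive rounded partial sums: they telescope, and each differs from `G i /
    -- (m + 1)` by less than one.
    refine ⟨Function.update g i ((S + G i) / (m + 1) - S / (m + 1)), fun j hj => ?_, ?_⟩
    · by_cases hji : j = i
      · subst hji
        rw [Function.update_self]
        omega
      · rw [Function.update_of_ne hji]
        exact hg j (Finset.mem_of_mem_insert_of_ne hj hji)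
    · rw [Finset.sum_insert hi, Finset.sum_insert hi, Function.update_self, add_comm (G i)]
      rw [Finset.sum_congr rfl fun j hj => Function.update_of_ne (by rintro rfl; exact hi hj) _ g,
        hsum]
      exact Nat.sub_add_cancel h1

/-- Of a total deficit at most `(m + 1) * u`, the factor split off takes the share rounded down, at
most `u`, and the rest keeps at most `m * u`. -/
theorem deficitIdeal_le_deficitIdeal_pow (f : Fin s → R) (B : Finset (Fin s)) (b u m : ℕ) :
    deficitIdeal f B (fun _ => m * b) (m * u + 1) ≤ deficitIdeal f B (fun _ => b) (u + 1) ^ m := by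
  induction m with
  | zero => simp
  | succ m ih =>
    refine Ideal.span_le.2 ?_
    rintro _ ⟨e, he, rfl⟩
    obtain ⟨g, hg, hsum⟩ := exists_balanced_div B (fun i => (m + 1) * b - e i) m b
      fun i _ => Nat.sub_le _ _
    set S := ∑ i ∈ B, ((m + 1) * b - e i)
    have hS : S ≤ (m + 1) * u := by omega
    have h5 : (m + 1) * b = m * b + b := by ring
    have hprod : ∏ i ∈ B, f i ^ e i =
        (∏ i ∈ B, f i ^ (b - g i)) * ∏ i ∈ B, f i ^ (e i - (b - g i)) := by
      rw [← Finset.prod_mul_distrib]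
      refine Finset.prod_congr rfl fun i hi => ?_
      rw [← pow_add]
      congr 1
      have := hg i hi
      omega
    rw [SetLike.mem_coe, hprod, pow_succ']
    refine Ideal.mul_mem_mul (prod_mem_deficitIdeal f ?_) (ih (prod_mem_deficitIdeal f ?_))
    · have h1 : ∑ i ∈ B, (b - (b - g i)) = ∑ i ∈ B, g i :=
        Finset.sum_congr rfl fun i hi => by have := hg i hi; omega
      have h2 : S / (m + 1) ≤ u := Nat.div_le_of_le_mul hS
      simp only [h1, hsum]
      omega
    · have h1 : ∑ i ∈ B, (m * b - (e i - (b - g i))) + ∑ i ∈ B, g i ≤ S := by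
        rw [← Finset.sum_add_distrib]
        refine Finset.sum_le_sum fun i hi => ?_
        have := hg i hi
        omega
      have h4 := add_div_le_div_add m S ((m + 1) * u - S)
      rw [Nat.add_sub_cancel' hS, Nat.mul_div_cancel_left _ (Nat.succ_pos m)] at h4
      have h6 : (m + 1) * u = m * u + u := by ring
      omega

lemma exists_le_sum_eq {ι : Type*} (B : Finset ι) (e : ι → ℕ) {a : ℕ} (h : a ≤ ∑ i ∈ B, e i) :
    ∃ e' : ι → ℕ, (∀ i ∈ B, e' i ≤ e i) ∧ ∑ i ∈ B, e' i = a := by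
  classical
  induction B using Finset.induction_on generalizing a with
  | empty => exact ⟨0, by simp, by simpa using (show a = 0 by simpa using h).symm⟩
  | insert i B hi ih =>
    rw [Finset.sum_insert hi] at h
    obtain ⟨e', h1, h2⟩ := ih (a := a - min a (e i)) (by omega)
    refine ⟨Function.update e' i (min a (e i)), fun j hj => ?_, ?_⟩
    · by_cases hji : j = i
      · subst hji; simp
      · rw [Function.update_of_ne hji]
        exact h1 j (Finset.mem_of_mem_insert_of_ne hj hji)
    · rw [Finset.sum_insert hi, Function.update_self,
        Finset.sum_congr rfl fun j hj => Function.update_of_ne (by rintro rfl; exact hi hj) _ e',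
        h2]
      omega

lemma exists_sum_eq_of_card_le {ι : Type*} (A : Finset ι) {b T : ℕ} (h1 : A.card ≤ T)
    (h2 : T ≤ b * A.card) :
    ∃ g : ι → ℕ, (∀ i ∈ A, 1 ≤ g i ∧ g i ≤ b) ∧ ∑ i ∈ A, g i = T := by
  rcases Nat.eq_zero_or_pos b with rfl | hb
  · have hT : T = 0 := by omega
    have hA : A = ∅ := Finset.card_eq_zero.1 (by omega)
    exact ⟨0, by simp [hA], by simp [hA, hT]⟩
  obtain ⟨b, rfl⟩ : ∃ b', b = b' + 1 := ⟨b - 1, by omega⟩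
  obtain ⟨e, h3, h4⟩ := exists_le_sum_eq A (fun _ => b) (a := T - A.card) (by
    rw [Finset.sum_const, smul_eq_mul]
    have : (b + 1) * A.card = A.card * b + A.card := by ring
    omega)
  refine ⟨fun i => e i + 1, fun i hi => ⟨Nat.le_add_left _ _, Nat.succ_le_succ (h3 i hi)⟩, ?_⟩
  rw [Finset.sum_add_distrib, h4, Finset.sum_const, smul_eq_mul]
  omega

lemma aFoldProductIdeal_eq_deficitIdeal (f : Fin s → R) {a b u : ℕ} (h : a + u = s * b) :
    aFoldProductIdeal f (fun _ => b) a = deficitIdeal f Finset.univ (fun _ => b) (u + 1) := by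
  have hsb : ∑ _i : Fin s, b = s * b := by simp
  refine le_antisymm (Ideal.span_le.2 ?_) (Ideal.span_le.2 ?_)
  · rintro _ ⟨e, he, hsum, rfl⟩
    refine prod_mem_deficitIdeal f ?_
    have : ∑ i, (b - e i) + ∑ i, e i = s * b := by
      rw [← Finset.sum_add_distrib, ← hsb]
      exact Finset.sum_congr rfl fun i _ => Nat.sub_add_cancel (he i)
    omega
  · rintro _ ⟨e, he, rfl⟩
    have he : ∑ i, (b - e i) < u + 1 := he
    have h1 : ∑ i, min (e i) b + ∑ i, (b - e i) = s * b := by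
      rw [← Finset.sum_add_distrib, ← hsb]
      exact Finset.sum_congr rfl fun i _ => by omega
    obtain ⟨e', h2, h3⟩ := exists_le_sum_eq Finset.univ (fun i => min (e i) b) (a := a) (by omega)
    have h4 : ∏ i, f i ^ e i = (∏ i, f i ^ (e i - e' i)) * ∏ i, f i ^ e' i := by
      rw [← Finset.prod_mul_distrib]
      refine Finset.prod_congr rfl fun i hi => ?_
      have := h2 i hi
      rw [← pow_add, Nat.sub_add_cancel (this.trans (min_le_left _ _))]
    rw [SetLike.mem_coe, h4]
    exact Ideal.mul_mem_left _ _
      (Ideal.subset_span ⟨e', fun i => (h2 i (Finset.mem_univ i)).trans (min_le_right _ _), h3, rfl⟩)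

/-! ### Associated primes and symbolic powers -/

lemma mem_associatedPrimes_quotient_iff [IsNoetherianRing R] {I p : Ideal R} :
    p ∈ associatedPrimes R (R ⧸ I) ↔ p.IsPrime ∧ ∃ w : R, ∀ r, r ∈ p ↔ r * w ∈ I := by
  rw [AssociatedPrimes.mem_iff, isAssociatedPrime_iff]
  refine and_congr_right fun _ => ⟨?_, ?_⟩
  · rintro ⟨x, rfl⟩
    obtain ⟨w, rfl⟩ := Ideal.Quotient.mk_surjective x
    refine ⟨w, fun r => ?_⟩
    rw [Submodule.mem_colon_singleton, Submodule.mem_bot, ← Ideal.Quotient.eq_zero_iff_mem]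
    rfl
  · rintro ⟨w, hw⟩
    refine ⟨Ideal.Quotient.mk I w, Ideal.ext fun r => ?_⟩
    rw [hw, Submodule.mem_colon_singleton, Submodule.mem_bot, ← Ideal.Quotient.eq_zero_iff_mem]
    rfl

lemma exists_mem_associatedPrimes_of_not_regularMod [IsNoetherianRing R] {I : Ideal R} {r : R}
    (h : ¬ RegularMod r I) : ∃ p ∈ associatedPrimes R (R ⧸ I), r ∈ p := by
  simp only [RegularMod, not_forall] at h
  obtain ⟨y, hy, hyI⟩ := h
  obtain ⟨p, hp, hle⟩ := exists_le_isAssociatedPrime_of_isNoetherianRing R (Ideal.Quotient.mk I y)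
    (by rwa [Ne, Ideal.Quotient.eq_zero_iff_mem])
  refine ⟨p, hp, hle ?_⟩
  rw [Submodule.mem_colon_singleton, Submodule.mem_bot]
  exact Ideal.Quotient.eq_zero_iff_mem.2 hy

lemma mem_symbolicPower_iff {I : Ideal R} {m : ℕ} {x : R} :
    x ∈ symbolicPower I m ↔ ∀ p ∈ associatedPrimes R (R ⧸ I), ∃ v ∉ p, v * x ∈ I ^ m := by
  simp only [symbolicPower, Ideal.mem_iInf, Ideal.mem_comap, Subtype.forall]
  refine forall_congr' fun p => forall_congr' fun hp => ?_
  have : p.IsPrime := hp.1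
  rw [IsLocalization.algebraMap_mem_map_algebraMap_iff p.primeCompl]
  rfl

/-- In the associated graded ring of `⟨f_A⟩`, the degree-one class of `f i` is a nonzerodivisor. -/
lemma mem_pow_of_mul_mem_pow_succ {f : Fin s → R} {A : Finset (Fin s)}
    (H : GenericMod ⊥ f A A.card) {i : Fin s} (hi : i ∈ A) {k : ℕ} {x : R}
    (hx : f i * x ∈ subfamilyIdeal f A ^ (k + 1)) : x ∈ subfamilyIdeal f A ^ k := by
  obtain ⟨A', hi', rfl⟩ : ∃ A', i ∉ A' ∧ insert i A' = A :=
    ⟨A.erase i, Finset.notMem_erase _ _, Finset.insert_erase hi⟩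
  have hsub := Finset.subset_insert i A'
  have hc := Finset.card_le_card hsub
  have := mem_of_mul_mem_sup_pow (C := ⊥) (regularMod_pow f A' ⊥ (H.mono hsub hc) _
    (H A' hsub hc i (Finset.mem_insert_self _ _) hi') (k + 1)) (x := x)
    (by rwa [bot_sup_eq, ← subfamilyIdeal_insert])
  rwa [bot_sup_eq, ← subfamilyIdeal_insert] at this

lemma mem_pow_of_prod_mul_mem_pow {f : Fin s → R} {A : Finset (Fin s)}
    (H : GenericMod ⊥ f A A.card) (e : Fin s → ℕ) {T : Finset (Fin s)} (hT : T ⊆ A) {k : ℕ} {x : R}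
    (hx : (∏ i ∈ T, f i ^ e i) * x ∈ subfamilyIdeal f A ^ (∑ i ∈ T, e i + k)) :
    x ∈ subfamilyIdeal f A ^ k := by
  induction T using Finset.induction_on with
  | empty => simpa using hx
  | insert i T hi ih =>
    rw [Finset.insert_subset_iff] at hT
    refine ih hT.2 ?_
    rw [Finset.prod_insert hi, Finset.sum_insert hi, mul_assoc] at hx
    generalize (∏ i ∈ T, f i ^ e i) * x = y at hx ⊢
    generalize e i = n at hx
    induction n with
    | zero => simpa using hx
    | succ n ihn =>
      refine ihn (mem_pow_of_mul_mem_pow_succ H hT.1 ?_)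
      rw [pow_succ', mul_assoc] at hx
      convert hx using 2
      omega

lemma regularMod_subfamilyIdeal_pow {f : Fin s → R} {B : Finset (Fin s)} {t : ℕ}
    (H : GenericMod ⊥ f B t) {A : Finset (Fin s)} (hA : A ⊆ B) (hc : A.card ≤ t) {h : R}
    (hh : RegularMod h (subfamilyIdeal f A)) (k : ℕ) : RegularMod h (subfamilyIdeal f A ^ k) := by
  simpa using regularMod_pow f A ⊥ (H.mono hA hc) h (by simpa using hh) k

lemma mem_deficitIdeal {f : Fin s → R} {B : Finset (Fin s)} {t : ℕ} (H : GenericMod ⊥ f B t)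
    (mult : Fin s → ℕ) {x : R}
    (hx : ∀ A ⊆ B, A.card ≤ t → x ∈ subfamilyIdeal f A ^ (∑ i ∈ A, mult i + 1 - t)) :
    x ∈ deficitIdeal f B mult t := by
  simpa using mem_sup_deficitIdeal f B t mult ⊥ H x (by simpa using hx)

/-- Every associated prime of a subfamily ideal is associated to the ideal of bounded deficit. -/
lemma mem_associatedPrimes_deficitIdeal [IsNoetherianRing R] {f : Fin s → R} {b u : ℕ}
    (H : GenericMod ⊥ f Finset.univ (u + 1)) {A : Finset (Fin s)} (hA : A.card ≤ u + 1)
    (hbA : u + 1 ≤ b * A.card) {p : Ideal R}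
    (hp : p ∈ associatedPrimes R (R ⧸ subfamilyIdeal f A)) :
    p ∈ associatedPrimes R (R ⧸ deficitIdeal f Finset.univ (fun _ => b) (u + 1)) := by
  rw [mem_associatedPrimes_quotient_iff] at hp ⊢
  obtain ⟨hpp, w, hw⟩ := hp
  -- A product with deficit exactly `u + 1`, positive at every index of `A` and zero elsewhere: one
  -- more factor `f i`, `i ∈ A`, puts it in the ideal, so its colon ideal is `⟨f_A⟩`.
  obtain ⟨g, hg, hgs⟩ := exists_sum_eq_of_card_le A hA hbA
  set e : Fin s → ℕ := fun i => if i ∈ A then b - g i else b with he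
  have hsplit : ∏ i, f i ^ e i = (∏ i ∈ Finset.univ \ A, f i ^ b) * ∏ i ∈ A, f i ^ (b - g i) := by
    rw [← Finset.prod_sdiff (Finset.subset_univ A)]
    congr 1
    · exact Finset.prod_congr rfl fun i hi => by simp [he, (Finset.mem_sdiff.1 hi).2]
    · exact Finset.prod_congr rfl fun i hi => by simp [he, hi]
  have hdef : ∑ i, (b - e i) = u + 1 := by
    rw [← Finset.sum_sdiff (Finset.subset_univ A), ← hgs,
      Finset.sum_eq_zero fun i hi => by simp [he, (Finset.mem_sdiff.1 hi).2], zero_add]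
    exact Finset.sum_congr rfl fun i hi => by have := hg i hi; simp only [he, hi, if_true]; omega
  have hle : subfamilyIdeal f A ≤ Submodule.comap (LinearMap.mulLeft R (∏ i, f i ^ e i))
      (deficitIdeal f Finset.univ (fun _ => b) (u + 1)) := by
    refine Ideal.span_le.2 ?_
    rintro _ ⟨i, hi, rfl⟩
    have hi : i ∈ A := hi
    rw [SetLike.mem_coe, Submodule.mem_comap, LinearMap.mulLeft_apply, mul_comm]
    refine mul_mem_deficitIdeal f (Finset.mem_univ i) _ _ (prod_mem_deficitIdeal f ?_)
    rw [← hdef]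
    refine Finset.sum_lt_sum (fun j _ => ?_) ⟨i, Finset.mem_univ i, ?_⟩
    · by_cases h : j = i
      · subst h; rw [Function.update_self]; omega
      · rw [Function.update_of_ne h]
    · have := hg i hi
      rw [Function.update_self]
      simp only [he, hi, if_true]
      omega
  refine ⟨hpp, (∏ i, f i ^ e i) * w, fun r => ?_⟩
  rw [hw, mul_left_comm]
  refine ⟨fun h => hle h, fun h => ?_⟩
  have h1 := deficitIdeal_le_pow f (Finset.subset_univ A) (fun _ => b) (u + 1) h
  rw [hsplit, mul_assoc] at h1
  have h2 := regularMod_subfamilyIdeal_pow H (Finset.subset_univ A) hA (RegularMod.prod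
    fun i hi => RegularMod.pow (by
      simpa using H A (Finset.subset_univ A) hA i (Finset.mem_univ i) (Finset.mem_sdiff.1 hi).2) b)
    _ _ h1
  -- The factors from `A` account for all but one of the exponent, leaving `r * w ∈ ⟨f_A⟩^1`.
  have h3 : ∑ _i ∈ A, b + 1 - (u + 1) = ∑ i ∈ A, (b - g i) + 1 := by
    have : ∑ i ∈ A, (b - g i) + ∑ i ∈ A, g i = ∑ _i ∈ A, b := by
      rw [← Finset.sum_add_distrib]
      exact Finset.sum_congr rfl fun i hi => Nat.sub_add_cancel (hg i hi).2
    have h4 : ∑ _i ∈ A, b = b * A.card := by simp [mul_comm]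
    omega
  rw [h3] at h2
  simpa using mem_pow_of_prod_mul_mem_pow (H.mono (Finset.subset_univ A) hA) _ subset_rfl h2

/-- The symbolic powers of the ideals of bounded deficit for a generic family. -/
theorem symbolicPower_deficitIdeal [IsNoetherianRing R] {f : Fin s → R} {u : ℕ} (b m : ℕ)
    (H : GenericMod ⊥ f Finset.univ (u + 1)) :
    symbolicPower (deficitIdeal f Finset.univ (fun _ => b) (u + 1)) m =
      ⨅ A : Finset (Fin s), ⨅ _ : A.card ≤ u + 1 ∧ u + 1 ≤ b * A.card,
        subfamilyIdeal f A ^ (m * (b * A.card - u)) := by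
  classical
  set I := deficitIdeal f Finset.univ (fun _ => b) (u + 1) with hI
  refine le_antisymm ?_ fun x hx => ?_
  · refine le_iInf fun A => le_iInf fun hA x hx => ?_
    rw [mem_symbolicPower_iff] at hx
    by_contra hxA
    set Q := Submodule.comap (LinearMap.mulRight R x) (subfamilyIdeal f A ^ (m * (b * A.card - u)))
    have hfin := associatedPrimes.finite R (R ⧸ subfamilyIdeal f A)
    -- If `x` is outside the power, `Q` consists of zerodivisors modulo `⟨f_A⟩`; prime avoidance
    -- puts it in one associated prime.
    have hQ : (Q : Set R) ⊆ ⋃ p ∈ (hfin.toFinset : Set (Ideal R)), (p : Set R) := by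
      intro r hr
      have : ¬ RegularMod r (subfamilyIdeal f A) := fun h =>
        hxA (regularMod_subfamilyIdeal_pow H (Finset.subset_univ A) hA.1 h _ x hr)
      obtain ⟨p, hp, hrp⟩ := exists_mem_associatedPrimes_of_not_regularMod this
      simp only [Set.mem_iUnion]
      exact ⟨p, by simpa using hp, hrp⟩
    rw [Ideal.subset_union_prime (f := fun p => p) ⊥ ⊥
      (fun p hp _ _ => ((Set.Finite.mem_toFinset hfin).1 hp).1)] at hQ
    obtain ⟨p, hp, hQp⟩ := hQ
    obtain ⟨v, hv, hvx⟩ := hx p (mem_associatedPrimes_deficitIdeal H hA.1 hA.2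
      ((Set.Finite.mem_toFinset hfin).1 hp))
    refine hv (hQp ?_)
    have hle := Ideal.pow_right_mono
      (deficitIdeal_le_pow f (Finset.subset_univ A) (fun _ => b) (u + 1)) m hvx
    rw [← pow_mul] at hle
    have hexp : (∑ _i ∈ A, b + 1 - (u + 1)) * m = m * (b * A.card - u) := by
      rw [Finset.sum_const, smul_eq_mul, Nat.add_sub_add_right, mul_comm, mul_comm b]
    rwa [hexp] at hle
  · simp only [Ideal.mem_iInf] at hx
    rw [mem_symbolicPower_iff]
    intro p hp
    rw [mem_associatedPrimes_quotient_iff] at hp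
    obtain ⟨hpp, w, hw⟩ := hp
    have hwI : w ∉ I := fun h => hpp.ne_top ((Ideal.eq_top_iff_one p).2 ((hw 1).2 (by simpa using h)))
    set B : Finset (Fin s) := Finset.univ.filter fun j => f j ∈ p with hB
    -- Otherwise each `A` misses some `j ∈ B`; since `f j * w ∈ I` and `f j` is regular modulo the
    -- powers of `⟨f_A⟩`, `w` would lie in `I`.
    have hBc : B.card ≤ u + 1 := by
      by_contra hBc
      refine hwI (mem_deficitIdeal H _ fun A _ hAc => ?_)
      obtain ⟨j, hjB, hjA⟩ : ∃ j ∈ B, j ∉ A := by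
        by_contra! h
        exact hBc ((Finset.card_le_card h).trans hAc)
      refine regularMod_subfamilyIdeal_pow H (Finset.subset_univ A) hAc (h := f j) ?_ _ _ ?_
      · simpa using H A (Finset.subset_univ A) hAc j (Finset.mem_univ j) hjA
      · exact deficitIdeal_le_pow f (Finset.subset_univ A) _ _
          ((hw _).1 (Finset.mem_filter.1 hjB).2)
    have hxB : x ∈ deficitIdeal f B (fun _ => b) (u + 1) ^ m := by
      refine deficitIdeal_le_deficitIdeal_pow f B b u m
        (mem_deficitIdeal ((H.mono (Finset.subset_univ B) le_rfl).of_card_le hBc _) _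
          fun A hAB _ => ?_)
      have hexp : ∑ _i ∈ A, m * b + 1 - (m * u + 1) = m * (b * A.card - u) := by
        rw [Finset.sum_const, smul_eq_mul, Nat.add_sub_add_right, Nat.mul_sub]
        congr 1
        ring
      rw [hexp]
      by_cases h : u + 1 ≤ b * A.card
      · exact hx A ⟨(Finset.card_le_card hAB).trans hBc, h⟩
      · rw [Nat.sub_eq_zero_of_le (by omega)]
        simp
    set v := ∏ j ∈ Finset.univ \ B, f j ^ b with hv
    have hvp : v ∉ p := by
      rw [hv, hpp.prod_mem_iff]
      rintro ⟨j, hj, hjp⟩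
      exact (Finset.mem_sdiff.1 hj).2 (by simpa [hB] using hpp.mem_of_pow_mem _ hjp)
    refine ⟨v ^ m, fun h => hvp (hpp.mem_of_pow_mem _ h), ?_⟩
    have hle : Ideal.span {v} * deficitIdeal f B (fun _ => b) (u + 1) ≤ I := by
      rw [deficitIdeal, Ideal.span_mul_span', Ideal.span_le]
      rintro _ ⟨_, rfl, _, ⟨e, he, rfl⟩, rfl⟩
      refine Ideal.subset_span ⟨fun i => if i ∈ B then e i else b, ?_, ?_⟩
      · rw [← Finset.sum_sdiff (Finset.subset_univ B),
          Finset.sum_eq_zero fun i hi => by simp [(Finset.mem_sdiff.1 hi).2], zero_add]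
        refine lt_of_le_of_lt (le_of_eq ?_) he
        exact Finset.sum_congr rfl fun i hi => by simp [hi]
      · rw [← Finset.prod_sdiff (Finset.subset_univ B)]
        refine congr_arg₂ _ ?_ ?_
        · exact Finset.prod_congr rfl fun i hi => by simp [(Finset.mem_sdiff.1 hi).2]
        · exact Finset.prod_congr rfl fun i hi => by simp [hi]
    refine Ideal.pow_right_mono hle m ?_
    rw [mul_pow]
    exact Ideal.mul_mem_mul (Ideal.pow_mem_pow (Ideal.mem_span_singleton_self v) m) hxB

/-! ### Star configurations and the numerical translation -/

/-- For `b = 1` the exponent `|A| - u` is one when `|A| = u + 1` and zero for smaller `A`. -/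
lemma starIdeal_eq_deficitIdeal {f : Fin s → R} {u : ℕ}
    (H : GenericMod ⊥ f Finset.univ (u + 1)) :
    starIdeal f (u + 1) = deficitIdeal f Finset.univ (fun _ => 1) (u + 1) := by
  refine le_antisymm (fun x hx => mem_deficitIdeal H _ fun A _ hA => ?_)
    (le_iInf fun A => le_iInf fun hA => ?_)
  · simp only [starIdeal, Ideal.mem_iInf] at hx
    rcases hA.lt_or_eq with h | h
    · have : ∑ _i ∈ A, 1 + 1 - (u + 1) = 0 := by simp; omega
      rw [this]
      simp
    · simpa [h] using hx A h
  · simpa [hA] using deficitIdeal_le_pow f (Finset.subset_univ A) (fun _ => 1) (u + 1)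

lemma symbolicPower_starIdeal [IsNoetherianRing R] {f : Fin s → R} {c : ℕ} (hc : 1 ≤ c) (m : ℕ)
    (H : GenericMod ⊥ f Finset.univ c) :
    symbolicPower (starIdeal f c) m =
      ⨅ A : Finset (Fin s), ⨅ _ : A.card = c, subfamilyIdeal f A ^ m := by
  obtain ⟨u, rfl⟩ : ∃ u, c = u + 1 := ⟨c - 1, by omega⟩
  rw [starIdeal_eq_deficitIdeal H, symbolicPower_deficitIdeal 1 m H]
  refine iInf_congr fun A => ?_
  by_cases h : A.card = u + 1
  · simp [h]
  · rw [iInf_neg h, iInf_neg (by omega)]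

lemma IsGeneric.genericMod {f : Fin s → R} {t : ℕ} (H : IsGeneric f t) :
    GenericMod ⊥ f Finset.univ t := by
  intro A _ hA j _ hj x hx
  have h1 := (H (A.toList ++ [j]) (by
    rw [List.nodup_append]
    refine ⟨A.nodup_toList, List.nodup_singleton _, ?_⟩
    simp only [Finset.mem_toList, List.mem_singleton]
    rintro a ha _ rfl rfl
    exact hj ha) (by simpa using hA)).toIsWeaklyRegular
  rw [List.map_append, RingTheory.Sequence.isWeaklyRegular_append_iff] at h1
  have h2 := (RingTheory.Sequence.isWeaklyRegular_singleton_iff _ _).1 h1.2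
  rw [isSMulRegular_quotient_iff_mem_of_smul_mem] at h2
  rw [bot_sup_eq] at hx ⊢
  have hA : Ideal.ofList (A.toList.map f) = subfamilyIdeal f A := by
    simp only [Ideal.ofList, subfamilyIdeal]
    congr 1
    ext y
    simp
  rw [smul_eq_mul, Ideal.mul_top, hA] at h2
  exact h2 x hx

/-- The symbolic powers of the `a`-fold product ideals of a generic family in a Noetherian ring. -/
theorem symbolicPower_aFoldProductIdeal [IsNoetherianRing R] {a b m δ c₀ μ : ℕ} (hb : 1 ≤ b)
    (has : a ≤ s * b) (ha : (b - 1) * s + 1 < a) (hδ : δ = a - (b - 1) * s - 1)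
    (hc₀ : c₀ = s - (a - 1) / b) (hμ : μ = a - b * (s - c₀))
    {f : Fin s → R} (hf : IsGeneric f (s - δ)) :
    symbolicPower (aFoldProductIdeal f (fun _ => b) a) m =
        (⨅ c ∈ Finset.Icc c₀ (s - δ), ⨅ A : Finset (Fin s), ⨅ _ : A.card = c,
          subfamilyIdeal f A ^ (m * (μ + b * (c - c₀)))) ∧
      symbolicPower (aFoldProductIdeal f (fun _ => b) a) m =
        (⨅ c ∈ Finset.Icc c₀ (s - δ),
          symbolicPower (starIdeal f c) (m * (μ + b * (c - c₀)))) := by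
  have hbs : (b - 1) * s + s = s * b := by
    obtain ⟨b, rfl⟩ : ∃ b', b = b' + 1 := ⟨b - 1, by omega⟩
    rw [Nat.add_sub_cancel]
    ring
  obtain ⟨u, hu⟩ : ∃ u, u = s * b - a := ⟨_, rfl⟩
  have hau : a + u = s * b := by omega
  have ht : s - δ = u + 1 := by omega
  rw [ht] at hf ⊢
  have H := hf.genericMod
  obtain ⟨q, hq⟩ : ∃ q, q = (a - 1) / b := ⟨_, rfl⟩
  have hdiv : b * q ≤ a - 1 := hq ▸ Nat.mul_div_le _ _
  have hdivs : q < s := hq ▸ Nat.div_lt_of_lt_mul (by rw [mul_comm]; omega)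
  rw [← hq] at hc₀
  have hc₀s : s - c₀ = q := by omega
  -- Thus `c₀` is the threshold at which the exponent `b * c - u` becomes positive.
  have hmem : ∀ c, c ≤ u + 1 → (c₀ ≤ c ↔ u + 1 ≤ b * c) := by
    intro c hc
    have h1 : c ≤ s := by omega
    have h2 : c₀ ≤ c ↔ s - c ≤ q := by omega
    rw [h2, hq, Nat.le_div_iff_mul_le (by omega), Nat.sub_mul, mul_comm b c]
    have := Nat.mul_le_mul_right b h1
    omega
  have hexp : ∀ c, c₀ ≤ c → c ≤ u + 1 → μ + b * (c - c₀) = b * c - u := by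
    intro c h1 h2
    obtain ⟨k, rfl⟩ := Nat.exists_eq_add_of_le h1
    have h3 : b * (s - c₀) + b * c₀ = s * b := by
      rw [← mul_add, Nat.sub_add_cancel (by omega), mul_comm]
    have h4 : b * (s - c₀) ≤ a - 1 := by rw [hc₀s]; exact hdiv
    rw [Nat.add_sub_cancel_left, mul_add]
    omega
  have hfirst : symbolicPower (aFoldProductIdeal f (fun _ => b) a) m =
      (⨅ c ∈ Finset.Icc c₀ (u + 1), ⨅ A : Finset (Fin s), ⨅ _ : A.card = c,
        subfamilyIdeal f A ^ (m * (μ + b * (c - c₀)))) := by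
    rw [aFoldProductIdeal_eq_deficitIdeal f hau,
      symbolicPower_deficitIdeal b m H]
    refine le_antisymm ?_ ?_
    · refine le_iInf fun c => le_iInf fun hc => le_iInf fun A => le_iInf fun hA => ?_
      subst hA
      rw [Finset.mem_Icc] at hc
      rw [hexp _ hc.1 hc.2]
      exact iInf₂_le A ⟨hc.2, (hmem _ hc.2).1 hc.1⟩
    · refine le_iInf fun A => le_iInf fun hA => ?_
      have hc := (hmem _ hA.1).2 hA.2
      rw [← hexp _ hc hA.1]
      refine (iInf₂_le A.card (Finset.mem_Icc.2 ⟨hc, hA.1⟩)).trans ?_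
      exact iInf₂_le (f := fun (A' : Finset (Fin s)) (_ : A'.card = A.card) =>
        subfamilyIdeal f A' ^ (m * (μ + b * (A.card - c₀)))) A rfl
  refine ⟨hfirst, hfirst.trans (iInf_congr fun c => iInf_congr fun hc => ?_)⟩
  rw [Finset.mem_Icc] at hc
  rw [symbolicPower_starIdeal (by omega) _ (H.mono subset_rfl hc.2)]

end

end StarConfig

theorem mainTheorem3 {K : Type*} [Field K] [Infinite K]
    (n s a b d m δ c₀ μ : ℕ)
    (hn : 1 ≤ n) (hb : 1 ≤ b) (hm : 1 ≤ m)
    (hs : n + 1 ≤ s) (has : a ≤ s * b)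
    (ha : (b - 1) * s + 1 < a)
    (hδ : δ = a - (b - 1) * s - 1) (hδn : s - n ≤ δ)
    (hc₀ : c₀ = s - (a - 1) / b)
    (hμ : μ = a - b * (s - c₀))
    (f : Fin s → MvPolynomial (Fin (n + 1)) K)
    (hd : ∀ i, (f i).IsHomogeneous d)
    (hf : StarConfig.IsGeneric f (s - δ)) :
    StarConfig.symbolicPower (StarConfig.aFoldProductIdeal f (fun _ => b) a) m =
        (⨅ c ∈ Finset.Icc c₀ (s - δ), ⨅ A : Finset (Fin s), ⨅ _ : A.card = c,
          StarConfig.subfamilyIdeal f A ^ (m * (μ + b * (c - c₀)))) ∧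
      StarConfig.symbolicPower (StarConfig.aFoldProductIdeal f (fun _ => b) a) m =
        (⨅ c ∈ Finset.Icc c₀ (s - δ),
          StarConfig.symbolicPower (StarConfig.starIdeal f c) (m * (μ + b * (c - c₀)))) := by
  exact StarConfig.symbolicPower_aFoldProductIdeal hb has ha hδ hc₀ hμ hf
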